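/- For a topological space $X$ let $\mathcal K(X)$ be the set of compact subsets of $X$, ordered by inclusion, and $\mathcal F(X)\subseteq\mathcal K(X)$ the set of finite subsets of $X$. If $P$ is a directed set and $P'\subseteq P$, a set $C\subseteq P$ is cofinal for $P'$ if every $p'\in P'$ satisfies $p'\le c$ for some $c\in C$. Write $(P',P)\ge_T(Q',Q)$ if there is a map $\phi:P\to Q$ which takes every subset of $P$ cofinal for $P'$ to a subset of $Q$ cofinal for $Q'$; the pairs are Tukey equivalent if $(P',P)\ge_T(Q',Q)$ and $(Q',Q)\ge_T(P',P)$. For a space $X$ let $F(X)$ (respectively $A(X)$) be the free topological group (free Abelian topological group) of $X$: the free group (free Abelian group) on $X$ with the coarsest group topology for which the canonical homomorphic extension of every continuous map from $X$ into a topological group (commutative topological group) is continuous. Let $L(X)$ be the free locally convex space of $X$: the real vector space with basis $X$, with the coarsest locally convex vector space topology for which the canonical linear extension of every continuous map from $X$ into a real locally convex topological vector space is continuous. Let $L_p(X)$ be the same vector space with the coarsest such topology for which the canonical linear extension of every continuous function $X\to\mathbb R$ is continuous. **Proposition.** Let $X$ and $Y$ be Tychonoff (completely regular Hausdorff) spaces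 and let $G$ be any one of $F$, $A$, $L$, $L_p$. If $G(X)$ and $G(Y)$ are topologically isomorphic (as topological groups for $F$ and $A$, as real topological vector spaces for $L$ and $L_p$), then $(\mathcal F(X),\mathcal K(X))$ and $(\mathcal F(Y),\mathcal K(Y))$ are Tukey equivalent. -/

import Mathlib

open TopologicalSpace

universe u v

/-! ### The relative Tukey order -/

/-- `C` is cofinal for `P'` in `P`. -/
def CofinalFor {P : Type u} [Preorder P] (P' C : Set P) : Prop :=
  ∀ p ∈ P', ∃ c ∈ C, p ≤ c

/-- The pair `(P', P)` Tukey quotients to the pair `(Q', Q)`: some map `P → Q` takes sets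
cofinal for `P'` to sets cofinal for `Q'`. -/
def TukeyQuotient {P : Type u} {Q : Type v} [Preorder P] [Preorder Q]
    (P' : Set P) (Q' : Set Q) : Prop :=
  ∃ φ : P → Q, ∀ C : Set P, CofinalFor P' C → CofinalFor Q' (φ '' C)

/-- Tukey equivalence of the pairs `(P', P)` and `(Q', Q)`. -/
def TukeyEquivalent {P : Type u} {Q : Type v} [Preorder P] [Preorder Q]
    (P' : Set P) (Q' : Set Q) : Prop :=
  TukeyQuotient P' Q' ∧ TukeyQuotient Q' P'

/-- The finite subsets of `X`, as a subset of the compact subsets of `X` ordered by inclusion. -/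
def finiteSubsets (X : Type u) [TopologicalSpace X] : Set (Compacts X) :=
  {K | (K : Set X).Finite}

/-! ### The free topological group -/

/-- The free topological group `F(X)`: the free group on `X`. -/
def FreeTopGroup (X : Type u) : Type u := FreeGroup X

namespace FreeTopGroup

variable (X : Type u)

instance : Group (FreeTopGroup X) := inferInstanceAs (Group (FreeGroup X))

/-- The canonical extension of a map from `X` into a group to a homomorphism. -/
def extend {X : Type u} {G : Type v} [Group G] (f : X → G) : FreeTopGroup X →* G :=
  FreeGroup.lift f

/-- The coarsest topology for which the canonical extension of every continuous map from `X` into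
a topological group is continuous; it is a group topology by the instance below. -/
instance [TopologicalSpace X] : TopologicalSpace (FreeTopGroup X) :=
  ⨅ (G : Type u) (_ : Group G) (_ : TopologicalSpace G) (_ : IsTopologicalGroup G) (f : C(X, G)),
    TopologicalSpace.induced (extend (f : X → G)) inferInstance

instance [TopologicalSpace X] : IsTopologicalGroup (FreeTopGroup X) :=
  topologicalGroup_iInf fun _ => topologicalGroup_iInf fun _ => topologicalGroup_iInf fun _ =>
    topologicalGroup_iInf fun _ => topologicalGroup_iInf fun f =>
      topologicalGroup_induced (extend f)

end FreeTopGroup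

/-! ### The free Abelian topological group -/

/-- The free Abelian topological group `A(X)`: the free Abelian group on `X`. -/
def FreeAbelianTopGroup (X : Type u) : Type u := FreeAbelianGroup X

namespace FreeAbelianTopGroup

variable (X : Type u)

instance : AddCommGroup (FreeAbelianTopGroup X) :=
  inferInstanceAs (AddCommGroup (FreeAbelianGroup X))

/-- The canonical extension of a map from `X` into an Abelian group to a homomorphism. -/
def extend {X : Type u} {G : Type v} [AddCommGroup G] (f : X → G) : FreeAbelianTopGroup X →+ G :=
  FreeAbelianGroup.lift f

/-- The coarsest topology for which the canonical extension of every continuous map from `X` into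
a commutative topological group is continuous; it is a group topology by the instance below. -/
instance [TopologicalSpace X] : TopologicalSpace (FreeAbelianTopGroup X) :=
  ⨅ (G : Type u) (_ : AddCommGroup G) (_ : TopologicalSpace G) (_ : IsTopologicalAddGroup G)
    (f : C(X, G)), TopologicalSpace.induced (extend (f : X → G)) inferInstance

instance [TopologicalSpace X] : IsTopologicalAddGroup (FreeAbelianTopGroup X) :=
  topologicalAddGroup_iInf fun _ => topologicalAddGroup_iInf fun _ =>
    topologicalAddGroup_iInf fun _ => topologicalAddGroup_iInf fun _ =>
      topologicalAddGroup_iInf fun f => topologicalAddGroup_induced (extend f)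

end FreeAbelianTopGroup

/-! ### The free locally convex space -/

/-- The free locally convex space `L(X)`: the real vector space with basis `X`. -/
def FreeLCS (X : Type u) : Type u := X →₀ ℝ

namespace FreeLCS

variable (X : Type u)

noncomputable instance : AddCommGroup (FreeLCS X) := inferInstanceAs (AddCommGroup (X →₀ ℝ))

noncomputable instance : Module ℝ (FreeLCS X) := inferInstanceAs (Module ℝ (X →₀ ℝ))

/-- The canonical linear extension of a map from `X` into a real vector space. -/
noncomputable def extend {X : Type u} {E : Type v} [AddCommGroup E] [Module ℝ E] (f : X → E) :
    FreeLCS X →ₗ[ℝ] E :=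
  Finsupp.linearCombination ℝ f

/-- The coarsest topology for which the canonical linear extension of every continuous map from `X`
into a locally convex topological vector space is continuous; it is a locally convex vector space
topology by the instances below. -/
noncomputable instance [TopologicalSpace X] : TopologicalSpace (FreeLCS X) :=
  ⨅ (E : Type u) (_ : AddCommGroup E) (_ : Module ℝ E) (_ : TopologicalSpace E)
    (_ : IsTopologicalAddGroup E) (_ : ContinuousSMul ℝ E) (_ : LocallyConvexSpace ℝ E)
    (f : C(X, E)), TopologicalSpace.induced (extend (f : X → E)) inferInstance

instance [TopologicalSpace X] : IsTopologicalAddGroup (FreeLCS X) :=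
  topologicalAddGroup_iInf fun _ => topologicalAddGroup_iInf fun _ =>
    topologicalAddGroup_iInf fun _ => topologicalAddGroup_iInf fun _ =>
    topologicalAddGroup_iInf fun _ => topologicalAddGroup_iInf fun _ =>
    topologicalAddGroup_iInf fun _ =>
      topologicalAddGroup_iInf fun f => topologicalAddGroup_induced (extend f)

instance [TopologicalSpace X] : ContinuousSMul ℝ (FreeLCS X) :=
  continuousSMul_iInf fun _ => continuousSMul_iInf fun _ => continuousSMul_iInf fun _ =>
    continuousSMul_iInf fun _ => continuousSMul_iInf fun _ => continuousSMul_iInf fun _ =>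
    continuousSMul_iInf fun _ => continuousSMul_iInf fun f => continuousSMul_induced (extend f)

instance [TopologicalSpace X] : LocallyConvexSpace ℝ (FreeLCS X) :=
  LocallyConvexSpace.iInf fun _ => LocallyConvexSpace.iInf fun _ => LocallyConvexSpace.iInf fun _ =>
    LocallyConvexSpace.iInf fun _ => LocallyConvexSpace.iInf fun _ => LocallyConvexSpace.iInf
    fun _ => LocallyConvexSpace.iInf fun _ => LocallyConvexSpace.iInf fun f =>
      LocallyConvexSpace.induced (extend f)

end FreeLCS

/-! ### The space `L_p(X)` -/

/-- The space `L_p(X)`: the real vector space with basis `X`. -/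
def FreeWeakLCS (X : Type u) : Type u := X →₀ ℝ

namespace FreeWeakLCS

variable (X : Type u)

noncomputable instance : AddCommGroup (FreeWeakLCS X) := inferInstanceAs (AddCommGroup (X →₀ ℝ))

noncomputable instance : Module ℝ (FreeWeakLCS X) := inferInstanceAs (Module ℝ (X →₀ ℝ))

/-- The canonical linear extension of a real-valued function on `X`. -/
noncomputable def extend {X : Type u} (f : X → ℝ) : FreeWeakLCS X →ₗ[ℝ] ℝ :=
  Finsupp.linearCombination ℝ f

/-- The coarsest topology for which the canonical linear extension of every continuous real-valued
function on `X` is continuous; it is a locally convex vector space topology by the instances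
below. -/
noncomputable instance [TopologicalSpace X] : TopologicalSpace (FreeWeakLCS X) :=
  ⨅ f : C(X, ℝ), TopologicalSpace.induced (extend (f : X → ℝ)) inferInstance

instance [TopologicalSpace X] : IsTopologicalAddGroup (FreeWeakLCS X) :=
  topologicalAddGroup_iInf fun f => topologicalAddGroup_induced (extend f)

instance [TopologicalSpace X] : ContinuousSMul ℝ (FreeWeakLCS X) :=
  continuousSMul_iInf fun f => continuousSMul_induced (extend f)

instance [TopologicalSpace X] : LocallyConvexSpace ℝ (FreeWeakLCS X) :=
  LocallyConvexSpace.iInf fun f => LocallyConvexSpace.induced (extend f)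

end FreeWeakLCS

/-! Each isomorphism G(X) ≅ G(Y), restricted to generators and followed by the coefficient map,
gives weakly continuous maps `toY` and `toX` into finitely supported functionals whose linear
extensions are mutually inverse. Only this `WeakDuality` is used afterwards, so all four functors
are treated at once.

For a Tukey quotient it suffices to attach to each y a finite set s(y) ⊆ X such that, for compact K,
the points with s(y) ⊆ K lie in a compact set. The natural choice is the support of `toX y`. The
points supported in K form the union of the sets `level K n`, each of which is compact, but the
union over n need not be.

If some countable subset of X lies in no compact set, its first points, up to index `size y`, are
added to s(y); then s(y) ⊆ K bounds n. Otherwise X is `OmegaBounded`, and this property passes to Y.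
The set of points supported in K is then closed and σ-compact in an ω-bounded space, hence compact.
The transfer to Y is the hard part: it combines Banach–Steinhaus bounds with a limit measure and
dominated convergence. -/

open Filter Topology Set

/-! ### Finitely supported functionals -/

/-- The value at `f` of the functional with coefficients `u`. -/
noncomputable def pairing {X : Type u} (w : X →₀ ℝ) (f : X → ℝ) : ℝ :=
  Finsupp.linearCombination ℝ f w

section Pairing

variable {X : Type u}

theorem pairing_eq_sum (w : X →₀ ℝ) (f : X → ℝ) :
    pairing w f = ∑ x ∈ w.support, w x * f x := by
  simp [pairing, Finsupp.linearCombination_apply, Finsupp.sum]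

@[simp] theorem pairing_single (x : X) (a : ℝ) (f : X → ℝ) :
    pairing (Finsupp.single x a) f = a * f x := by
  simp [pairing]

theorem pairing_sum {ι : Type*} (s : Finset ι) (w : ι → X →₀ ℝ) (f : X → ℝ) :
    pairing (∑ i ∈ s, w i) f = ∑ i ∈ s, pairing (w i) f := by
  simp [pairing]

theorem pairing_smul (a : ℝ) (w : X →₀ ℝ) (f : X → ℝ) :
    pairing (a • w) f = a * pairing w f := by
  simp [pairing]

theorem pairing_eq_zero {w : X →₀ ℝ} {f : X → ℝ} (h : ∀ x ∈ w.support, f x = 0) :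
    pairing w f = 0 := by
  rw [pairing_eq_sum]
  exact Finset.sum_eq_zero fun x hx => by rw [h x hx, mul_zero]

theorem pairing_eq_apply {w : X →₀ ℝ} {f : X → ℝ} {x : X}
    (hx : f x = 1) (h : ∀ z ∈ w.support, z ≠ x → f z = 0) : pairing w f = w x := by
  rw [pairing_eq_sum, Finset.sum_eq_single x, hx, mul_one]
  · exact fun z hz hzx => by rw [h z hz hzx, mul_zero]
  · exact fun hx => by simp [Finsupp.notMem_support_iff.1 hx]

theorem pairing_injective {w w' : X →₀ ℝ} (h : ∀ f, pairing w f = pairing w' f) : w = w' := by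
  classical
  ext x
  have key : ∀ w : X →₀ ℝ, pairing w (Pi.single x 1) = w x := fun w =>
    pairing_eq_apply (by simp) fun z _ hz => by simp [hz]
  rw [← key, ← key, h]

theorem abs_pairing_le (w : X →₀ ℝ) (f : X → ℝ) :
    |pairing w f| ≤ ∑ x ∈ w.support, |w x| * |f x| := by
  rw [pairing_eq_sum]
  exact (Finset.abs_sum_le_sum_abs _ _).trans_eq (by simp [abs_mul])

end Pairing

/-! ### Separation in Tychonoff spaces -/

section Separation

variable {X : Type u} [TopologicalSpace X] [T35Space X]

theorem exists_continuousMap_one_zero {x : X} {C : Set X} (hC : IsClosed C) (hx : x ∉ C) :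
    ∃ f : C(X, ℝ), f x = 1 ∧ (∀ z ∈ C, f z = 0) ∧ ∀ z, f z ∈ Icc (0 : ℝ) 1 := by
  obtain ⟨f, hf, hfx, hfC⟩ := CompletelyRegularSpace.completely_regular x C hC hx
  refine ⟨⟨fun z => 1 - f z, by fun_prop⟩, by simp [hfx], fun z hz => ?_, fun z => ?_⟩
  · simp [hfC hz]
  · exact ⟨by simpa using (f z).2.2, by simpa using (f z).2.1⟩

theorem exists_continuousMap_single {x : X} {C : Set X} (hC : IsClosed C) (hx : x ∉ C)
    (s : Finset X) :
    ∃ f : C(X, ℝ), f x = 1 ∧ (∀ z ∈ C, f z = 0) ∧ (∀ z ∈ s, z ≠ x → f z = 0) ∧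
      ∀ z, f z ∈ Icc (0 : ℝ) 1 := by
  classical
  obtain ⟨f, hfx, hf, hf1⟩ := exists_continuousMap_one_zero
    (x := x) (hC.union (s.erase x).finite_toSet.isClosed) (by simp [hx])
  exact ⟨f, hfx, fun z hz => hf z (Or.inl hz),
    fun z hz hzx => hf z (Or.inr (by simp [hz, hzx])), hf1⟩

theorem exists_continuousMap_interpolate (s : Finset X) (c : X → ℝ) {M : ℝ}
    (hc : ∀ x ∈ s, |c x| ≤ M) (hM : 0 ≤ M) :
    ∃ f : C(X, ℝ), (∀ x ∈ s, f x = c x) ∧ ∀ x, |f x| ≤ M := by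
  choose e he1 _ he0 _ using fun x : X =>
    exists_continuousMap_single (x := x) isClosed_empty (notMem_empty x) s
  -- Clamping to [-M, M] keeps the prescribed values on `s` and makes the bound global.
  refine ⟨⟨fun z => max (-M) (min M (∑ x ∈ s, c x * e x z)), by fun_prop⟩, fun x hx => ?_,
    fun x => ?_⟩
  · have : ∑ z ∈ s, c z * e z x = c x := by
      rw [Finset.sum_eq_single x, he1, mul_one]
      · exact fun z _ hz => by rw [he0 z x hx hz.symm, mul_zero]
      · exact fun h => absurd hx h
    have h := abs_le.1 (hc x hx)
    simp [this, h.1, h.2]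
  · rw [abs_le]
    exact ⟨le_max_left _ _, max_le (by linarith) (min_le_left _ _)⟩

/-- The points of a Tychonoff space are closed among the finitely supported functionals. -/
theorem exists_eq_single_of_tendsto {F : Filter X} [NeBot F] {w : X →₀ ℝ}
    (h : ∀ f : C(X, ℝ), Tendsto f F (𝓝 (pairing w f))) :
    ∃ x, w = Finsupp.single x 1 ∧ F ≤ 𝓝 x := by
  have h1 : pairing w (1 : X → ℝ) = 1 :=
    tendsto_nhds_unique (h 1) (tendsto_const_nhds (x := (1 : ℝ)))
  have hcoeff : ∀ x ∈ w.support, w x = 1 := by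
    intro x hx
    obtain ⟨f, hfx, -, hf, -⟩ :=
      exists_continuousMap_single isClosed_empty (notMem_empty x) w.support
    -- `f` and `f * f` both pair with `w` to `w x`, while limits respect products, so `w x` is
    -- idempotent. As the coefficients sum to 1, the support is a single point.
    have hf1 := h f
    have hf2 := h (f * f)
    rw [pairing_eq_apply hfx hf] at hf1
    rw [pairing_eq_apply (x := x) (by simp [hfx]) (fun z hz hzx => by simp [hf z hz hzx])] at hf2
    have := tendsto_nhds_unique hf2 (hf1.mul hf1)
    have hw : w x ≠ 0 := Finsupp.mem_support_iff.1 hx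
    exact (mul_left_cancel₀ hw (by linarith : w x * w x = w x * 1))
  have hcard : w.support.card = 1 := by
    rw [pairing_eq_sum, Finset.sum_congr rfl fun x hx => by rw [hcoeff x hx]] at h1
    simpa using h1
  obtain ⟨x, hx⟩ := Finset.card_eq_one.1 hcard
  have hw : w = Finsupp.single x 1 := by
    rw [← hcoeff x (by simp [hx])]
    exact (Finsupp.support_eq_singleton.1 hx).2
  refine ⟨x, hw, fun V hV => ?_⟩
  obtain ⟨O, hOV, hO, hxO⟩ := mem_nhds_iff.1 hV
  obtain ⟨f, hfx, hf, -⟩ := exists_continuousMap_one_zero hO.isClosed_compl (by simpa using hxO)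
  have hlim := h f
  rw [hw, pairing_single, hfx, mul_one] at hlim
  filter_upwards [hlim.eventually (lt_mem_nhds one_half_lt_one)] with z hz
  by_contra hzV
  rw [hf z fun hz => hzV (hOV hz)] at hz
  norm_num at hz

end Separation

/-! ### Dual pairs of weakly continuous maps -/

/-- Two weakly continuous maps from `X` and `Y` into the finitely supported functionals on the
other space, whose linear extensions are inverse to each other. -/
structure WeakDuality (X : Type u) (Y : Type v) [TopologicalSpace X] [TopologicalSpace Y] where
  /-- The functional on `Y` that corresponds to a point of `X`. -/
  toY : X → Y →₀ ℝ
  /-- The functional on `X` that corresponds to a point of `Y`. -/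
  toX : Y → X →₀ ℝ
  continuous_toY : ∀ f : C(Y, ℝ), Continuous fun x => pairing (toY x) f
  continuous_toX : ∀ f : C(X, ℝ), Continuous fun y => pairing (toX y) f
  toX_toY : ∀ (y : Y) (f : Y → ℝ), pairing (toX y) (fun x => pairing (toY x) f) = f y
  toY_toX : ∀ (x : X) (f : X → ℝ), pairing (toY x) (fun y => pairing (toX y) f) = f x

namespace WeakDuality

variable {X : Type u} {Y : Type v} [TopologicalSpace X] [TopologicalSpace Y]

/-- Exchange the two spaces. -/
def symm (d : WeakDuality X Y) : WeakDuality Y X where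
  toY := d.toX
  toX := d.toY
  continuous_toY := d.continuous_toX
  continuous_toX := d.continuous_toY
  toX_toY := d.toY_toX
  toY_toX := d.toX_toY

/-- The continuous function on `X` that corresponds to a continuous function on `Y`. -/
noncomputable def pull (d : WeakDuality X Y) (f : C(Y, ℝ)) : C(X, ℝ) :=
  ⟨fun x => pairing (d.toY x) f, d.continuous_toY f⟩

theorem pull_apply (d : WeakDuality X Y) (f : C(Y, ℝ)) (x : X) :
    d.pull f x = pairing (d.toY x) f := rfl

theorem pairing_pull (d : WeakDuality X Y) (f : C(Y, ℝ)) (y : Y) :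
    pairing (d.toX y) (d.pull f) = f y :=
  d.toX_toY y f

/-- A support point x of a limit outside K would be detected by a function that is 1 at x and 0 on K
and at the other support points: its pairing vanishes on the set, hence at the limit, yet equals the
nonzero coefficient at x. -/
theorem isClosed_support_subset [T35Space X] (d : WeakDuality X Y) {K : Set X} (hK : IsClosed K) :
    IsClosed {y | ((d.toX y).support : Set X) ⊆ K} := by
  refine isClosed_of_closure_subset fun y hy x hx => ?_
  by_contra hxK
  obtain ⟨f, hfx, hfK, hf, -⟩ := exists_continuousMap_single hK hxK (d.toX y).support
  have hy' : y ∈ {y | pairing (d.toX y) f = 0} :=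
    closure_minimal (fun z (hz : ((d.toX z).support : Set X) ⊆ K) =>
        pairing_eq_zero fun x hx => hfK x (hz hx))
      (isClosed_eq (d.continuous_toX f) continuous_const) hy
  exact Finsupp.mem_support_iff.1 hx ((pairing_eq_apply hfx hf).symm.trans hy')

/-- The points of `Y` that correspond to combinations of `m` points of `K` with coefficients
bounded by `r`. -/
def boundedPart (d : WeakDuality X Y) (K : Set X) (m r : ℕ) : Set Y :=
  {y | ∃ p : Fin m → ℝ × X, p ∈ Set.univ.pi (fun _ => Icc (-(r : ℝ)) r ×ˢ K) ∧
    d.toX y = ∑ i, Finsupp.single (p i).2 (p i).1}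

/-- The parameters range over a compact power of [-r, r] × K. A limit of parameters gives a weak
limit of the functionals, and transporting it to Y gives a weak limit of point masses, which is
again a point mass. -/
theorem isCompact_boundedPart [T35Space Y] (d : WeakDuality X Y) {K : Set X} (hK : IsCompact K)
    (m r : ℕ) : IsCompact (d.boundedPart K m r) := by
  rw [isCompact_iff_ultrafilter_le_nhds]
  intro U hU
  rw [le_principal_iff] at hU
  obtain ⟨y₀, p₀, -⟩ := U.nonempty_of_mem hU
  have : Nonempty (Fin m → ℝ × X) := ⟨p₀⟩
  choose! p hp hpy using fun y (hy : y ∈ d.boundedPart K m r) => hy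
  obtain ⟨q, hq, hUq⟩ := isCompact_iff_ultrafilter_le_nhds.1
    (isCompact_univ_pi fun _ : Fin m => (isCompact_Icc (a := -(r : ℝ)) (b := r)).prod hK)
    (U.map p) (by
      rw [le_principal_iff]
      exact Ultrafilter.mem_map.2 (mem_of_superset hU hp))
  have hUq : Tendsto p U (𝓝 q) := hUq
  have hX : ∀ g : C(X, ℝ), Tendsto (fun y => pairing (d.toX y) g) U
      (𝓝 (pairing (∑ i, Finsupp.single (q i).2 (q i).1) g)) := by
    intro g
    have hc : Continuous fun p : Fin m → ℝ × X => ∑ i, (p i).1 * g (p i).2 := by fun_prop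
    have := (hc.tendsto q).comp hUq
    simp only [pairing_sum, pairing_single]
    refine this.congr' ?_
    filter_upwards [hU] with y hy
    simp [hpy y hy, pairing_sum]
  -- The image of the limiting combination under the linear extension of `toY`, hence the only
  -- candidate for the limit.
  set w : Y →₀ ℝ := ∑ i, (q i).1 • d.toY (q i).2 with hw
  have hwf : ∀ f : Y → ℝ, pairing w f =
      pairing (∑ i, Finsupp.single (q i).2 (q i).1) fun x => pairing (d.toY x) f := by
    intro f
    simp [hw, pairing_sum, pairing_smul]
  obtain ⟨y, hy, hUy⟩ := exists_eq_single_of_tendsto (F := U) (w := w) fun f => by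
    rw [hwf]
    exact (hX (d.pull f)).congr fun y => d.pairing_pull f y
  refine ⟨y, ⟨q, hq, pairing_injective fun g => ?_⟩, hUy⟩
  have := hwf fun y => pairing (d.toX y) g
  rw [hy, pairing_single, one_mul] at this
  simpa only [d.toY_toX] using this

/-- A number that bounds the length and the coefficients of the functional of `y`. -/
noncomputable def size (d : WeakDuality X Y) (y : Y) : ℕ :=
  max (d.toX y).support.card ⌈∑ x ∈ (d.toX y).support, |d.toX y x|⌉₊

/-- The points of `Y` that correspond to combinations of at most `n` points of `K` with
coefficients bounded by `n`. -/
def level (d : WeakDuality X Y) (K : Set X) (n : ℕ) : Set Y :=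
  ⋃ m ∈ Iic n, ⋃ r ∈ Iic n, d.boundedPart K m r

theorem isCompact_level [T35Space Y] (d : WeakDuality X Y) {K : Set X} (hK : IsCompact K)
    (n : ℕ) : IsCompact (d.level K n) :=
  (finite_Iic n).isCompact_biUnion fun m _ => (finite_Iic n).isCompact_biUnion fun r _ =>
    d.isCompact_boundedPart hK m r

theorem mem_level (d : WeakDuality X Y) {K : Set X} {y : Y} {n : ℕ}
    (hy : ((d.toX y).support : Set X) ⊆ K) (hn : d.size y ≤ n) : y ∈ d.level K n := by
  have h1 : (d.toX y).support.card ≤ n := (le_max_left _ _).trans hn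
  have h2 : ⌈∑ x ∈ (d.toX y).support, |d.toX y x|⌉₊ ≤ n := (le_max_right _ _).trans hn
  refine mem_biUnion (mem_Iic.2 h1) (mem_biUnion (mem_Iic.2 h2) ?_)
  let e := (d.toX y).support.equivFin.symm
  refine ⟨fun i => (d.toX y (e i), e i), fun i _ => ⟨?_, hy (e i).2⟩, ?_⟩
  · exact abs_le.1 <| (Finset.single_le_sum (f := fun x => |d.toX y x|) (fun x _ => abs_nonneg _)
      (e i).2).trans (Nat.le_ceil _)
  · calc d.toX y = ∑ x ∈ (d.toX y).support, Finsupp.single x (d.toX y x) :=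
        (Finsupp.sum_single _).symm
      _ = ∑ x : (d.toX y).support, Finsupp.single (x : X) (d.toX y x) :=
        (Finset.sum_coe_sort _ fun x => Finsupp.single x (d.toX y x)).symm
      _ = _ := (e.sum_comp fun x => Finsupp.single (x : X) (d.toX y x)).symm

theorem support_subset_of_mem_level (d : WeakDuality X Y) {K : Set X} {y : Y} {n : ℕ}
    (hy : y ∈ d.level K n) : ((d.toX y).support : Set X) ⊆ K := by
  classical
  simp only [level, mem_iUnion] at hy
  obtain ⟨m, -, r, -, p, hp, hpy⟩ := hy
  intro x hx
  rw [hpy] at hx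
  obtain ⟨i, -, hi⟩ := Finset.mem_biUnion.1 (Finsupp.support_finsetSum hx)
  rw [Finset.mem_singleton.1 (Finsupp.support_single_subset hi)]
  exact (hp i (mem_univ i)).2

end WeakDuality

/-! ### Uniform bounds -/

section Bounds

/-- Banach–Steinhaus on bounded continuous functions: the norm of a finitely supported functional
dominates its ℓ¹ norm, as testing on a function that interpolates the signs of the coefficients
shows. -/
theorem exists_sum_abs_le {ι : Type*} {X : Type u} [TopologicalSpace X] [T35Space X]
    (w : ι → X →₀ ℝ)
    (hw : ∀ f : BoundedContinuousFunction X ℝ, ∃ C, ∀ i, |pairing (w i) f| ≤ C) :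
    ∃ M, ∀ i, ∑ x ∈ (w i).support, |w i x| ≤ M := by
  let T : ι → BoundedContinuousFunction X ℝ →L[ℝ] ℝ := fun i =>
    ∑ x ∈ (w i).support, w i x • BoundedContinuousFunction.evalCLM ℝ x
  have hT : ∀ i f, T i f = pairing (w i) f := fun i f => by
    simp [T, pairing_eq_sum]
  obtain ⟨M, hM⟩ := banach_steinhaus (g := T) fun f => by
    simpa only [hT, Real.norm_eq_abs] using hw f
  refine ⟨M, fun i => ?_⟩
  obtain ⟨f, hf, hf1⟩ := exists_continuousMap_interpolate (w i).support
    (fun x => (SignType.sign (w i x) : ℝ)) (M := 1)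
    (fun x _ => by rcases SignType.sign (w i x) with _ | _ | _ <;> simp) zero_le_one
  let g := BoundedContinuousFunction.ofNormedAddCommGroup f f.continuous 1 hf1
  have hg : ‖g‖ ≤ 1 :=
    BoundedContinuousFunction.norm_ofNormedAddCommGroup_le f.continuous zero_le_one hf1
  calc ∑ x ∈ (w i).support, |w i x| = pairing (w i) g := by
        rw [pairing_eq_sum]
        refine Finset.sum_congr rfl fun x hx => ?_
        rw [show g x = (SignType.sign (w i x) : ℝ) from hf x hx, self_mul_sign]
    _ = T i g := (hT i g).symm
    _ ≤ ‖T i g‖ := le_abs_self _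
    _ ≤ ‖T i‖ * ‖g‖ := (T i).le_opNorm g
    _ ≤ M * 1 := mul_le_mul (hM i) hg (norm_nonneg _) ((norm_nonneg _).trans (hM i))
    _ = M := mul_one M

namespace WeakDuality

variable {X : Type u} {Y : Type v} [TopologicalSpace X] [TopologicalSpace Y]

/-- A continuous function on `Y` is bounded on the points that correspond to functionals
supported in a fixed compact set. -/
theorem exists_abs_le (d : WeakDuality X Y) {K : Set X} (hK : IsCompact K) (f : C(Y, ℝ)) :
    ∃ B, ∀ y, ((d.toX y).support : Set X) ⊆ K → |f y| ≤ B := by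
  -- The family p ↦ `d.pull (p.comp f) x`, x ∈ K, is pointwise bounded by compactness of K, hence
  -- equicontinuous. So one compact `Q` ⊆ ℝ controls all of it, and B is chosen to bound `Q`.
  let T : K → C(ℝ, ℝ) →L[ℝ] ℝ := fun x =>
    ∑ y ∈ (d.toY x).support, d.toY x y • ContinuousMap.evalCLM ℝ (f y)
  have hT : ∀ x p, T x p = d.pull (p.comp f) x := fun x p => by
    simp [T, pull_apply, pairing_eq_sum]
  have : IsUniformAddGroup C(ℝ, ℝ) := IsUniformInducing.isUniformAddGroup
    ({ toFun := fun p => UniformOnFun.ofFun {Q : Set ℝ | IsCompact Q} p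
       map_zero' := rfl
       map_add' := fun _ _ => rfl } : C(ℝ, ℝ) →+ UniformOnFun ℝ ℝ {Q : Set ℝ | IsCompact Q})
    ContinuousMap.isUniformEmbedding_toUniformOnFunIsCompact.isUniformInducing
  have hequi := (norm_withSeminorms ℝ ℝ).banach_steinhaus (𝓕 := T) fun _ p => by
    obtain ⟨C, hC⟩ := hK.exists_bound_of_continuousOn (d.pull (p.comp f)).continuous.continuousOn
    refine ⟨C, ?_⟩
    rintro _ ⟨x, rfl⟩
    simpa [hT] using hC x x.2
  have hnear := Metric.equicontinuousAt_iff_right.1 (hequi.equicontinuous 0) 1 one_pos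
  obtain ⟨⟨Q, ε⟩, ⟨hQ, hε⟩, hsub⟩ := (nhds_basis_uniformity'
    (Metric.uniformity_basis_dist (α := ℝ)).compactConvergenceUniformity).mem_iff.1 hnear
  obtain ⟨B, hB⟩ := hQ.exists_bound_of_continuousOn (f := id) continuousOn_id
  refine ⟨B, fun y hy => ?_⟩
  by_contra! hlt
  let p : C(ℝ, ℝ) := ⟨fun t => max 0 (|t| - B), by fun_prop⟩
  have hpull : ∀ x ∈ K, d.pull (p.comp f) x = 0 := by
    intro x hx
    by_contra hne
    set a := d.pull (p.comp f) x with ha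
    -- `p` vanishes on `Q`, so every multiple of it lies in the neighbourhood; this one would be
    -- sent to 1 by `T x`.
    have hmem : a⁻¹ • p ∈ {q : C(ℝ, ℝ) | ∀ x, dist ((DFunLike.coe ∘ T) x 0)
        ((DFunLike.coe ∘ T) x q) < 1} := hsub fun t ht => by
      have : |t| ≤ B := hB t ht
      simpa [p, this] using hε
    have := hmem ⟨x, hx⟩
    simp only [Function.comp_apply, map_zero, map_smul] at this
    rw [hT, ← ha] at this
    simp [hne] at this
  have h0 : p (f y) = 0 := by
    rw [← ContinuousMap.comp_apply, ← d.pairing_pull]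
    exact pairing_eq_zero fun x hx => hpull x (hy hx)
  have : 0 < p (f y) := lt_max_of_lt_right (by linarith)
  exact this.ne' h0

theorem exists_sum_abs_toX_le [T35Space X] (d : WeakDuality X Y) {K : Set X} (hK : IsCompact K) :
    ∃ M, ∀ y, ((d.toX y).support : Set X) ⊆ K →
      ∑ x ∈ (d.toX y).support, |d.toX y x| ≤ M := by
  obtain ⟨M, hM⟩ := exists_sum_abs_le
    (fun y : {y | ((d.toX y).support : Set X) ⊆ K} => d.toX y) fun g => by
      obtain ⟨B, hB⟩ := d.exists_abs_le hK (d.symm.pull g)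
      exact ⟨B, fun y => hB y y.2⟩
  exact ⟨M, fun y hy => hM ⟨y, hy⟩⟩

theorem exists_sum_abs_toY_le [T35Space Y] (d : WeakDuality X Y) {K : Set X} (hK : IsCompact K) :
    ∃ M, ∀ x ∈ K, ∑ y ∈ (d.toY x).support, |d.toY x y| ≤ M := by
  obtain ⟨M, hM⟩ := exists_sum_abs_le (fun x : K => d.toY x) fun g => by
    obtain ⟨B, hB⟩ := hK.exists_bound_of_continuousOn (d.pull g).continuous.continuousOn
    exact ⟨B, fun x => hB x x.2⟩
  exact ⟨M, fun x hx => hM ⟨x, hx⟩⟩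

end WeakDuality

end Bounds

/-! ### Bounded convergence for limits of finitely supported functionals -/

/-- The absolute values of the `w y` are positive functionals on C(K) of bounded mass. Their limit
along `U` is, by Riesz, integration against a finite measure; dominated convergence picks an n with
small integral of |`g n`|, and this n then works for `U`-almost all y. -/
theorem exists_eventually_abs_pairing_lt {X : Type u} {Y : Type v} [TopologicalSpace X] [T2Space X]
    {K : Set X} (hK : IsCompact K) (U : Ultrafilter Y) (w : Y → X →₀ ℝ) {M : ℝ}
    (hwK : ∀ᶠ y in U, ((w y).support : Set X) ⊆ K)
    (hwM : ∀ᶠ y in U, ∑ x ∈ (w y).support, |w y x| ≤ M)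
    (g : ℕ → C(X, ℝ)) {B : ℝ} (hB : ∀ n, ∀ x ∈ K, |g n x| ≤ B)
    (hg : ∀ x ∈ K, Tendsto (fun n => g n x) atTop (𝓝 0)) {ε : ℝ} (hε : 0 < ε) :
    ∃ n, ∀ᶠ y in U, |pairing (w y) (g n)| < ε := by
  classical
  have : CompactSpace K := isCompact_iff_compactSpace.1 hK
  let _ : MeasurableSpace K := borel K
  have : BorelSpace K := ⟨rfl⟩
  let A : Y → (K → ℝ) → ℝ := fun y f =>
    ((w y).subtypeDomain (· ∈ K)).sum fun x a => |a| * f x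
  have hA : ∀ᶠ y in U, ∀ f : X → ℝ, A y (fun x => f x) = ∑ x ∈ (w y).support, |w y x| * f x := by
    filter_upwards [hwK] with y hy f
    exact Finsupp.sum_subtypeDomain_index (h := fun x a => |a| * f x) fun x hx => hy hx
  have hbound : ∀ f : C(K, ℝ), ∀ᶠ y in U, A y f ∈ Icc (-(M * ‖f‖)) (M * ‖f‖) := by
    intro f
    filter_upwards [hA, hwM] with y hy hM
    rw [mem_Icc, ← abs_le]
    have h1 : A y (fun _ => 1) ≤ M := by simpa [hy fun _ => 1] using hM
    calc |A y f| ≤ A y (fun _ => 1) * ‖f‖ := by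
          simp only [A, Finsupp.sum, Finset.sum_mul]
          refine (Finset.abs_sum_le_sum_abs _ _).trans (Finset.sum_le_sum fun x _ => ?_)
          rw [abs_mul, abs_abs, mul_one]
          exact mul_le_mul_of_nonneg_left (f.norm_coe_le_norm x) (abs_nonneg _)
      _ ≤ M * ‖f‖ := mul_le_mul_of_nonneg_right h1 (norm_nonneg _)
  have hlim : ∀ f : C(K, ℝ), ∃ l, Tendsto (fun y => A y f) U (𝓝 l) := fun f => by
    obtain ⟨l, -, hl⟩ := isCompact_Icc.ultrafilter_le_nhds (U.map fun y => A y f)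
      (by rw [le_principal_iff]; exact hbound f)
    exact ⟨l, hl⟩
  choose L hL using hlim
  let Λ : CompactlySupportedContinuousMap K ℝ →ₚ[ℝ] ℝ := PositiveLinearMap.mk₀
    { toFun := fun f => L f.toContinuousMap
      map_add' := fun f h => tendsto_nhds_unique (hL _) <|
        ((hL f.toContinuousMap).add (hL h.toContinuousMap)).congr fun y => by
          simp [A, Finsupp.sum, mul_add, Finset.sum_add_distrib]
      map_smul' := fun c f => tendsto_nhds_unique (hL _) <|
        ((hL f.toContinuousMap).const_mul c).congr fun y => by
          simp only [A, Finsupp.sum, Finset.mul_sum]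
          refine Finset.sum_congr rfl fun x _ => ?_
          simp [mul_left_comm] }
    fun f hf => ge_of_tendsto' (hL _) fun y => Finset.sum_nonneg fun x _ =>
      mul_nonneg (abs_nonneg _) (hf x)
  let G : ℕ → CompactlySupportedContinuousMap K ℝ := fun n =>
    ⟨⟨fun x => |g n x|, by fun_prop⟩, HasCompactSupport.of_compactSpace _⟩
  have hfin : MeasureTheory.IsFiniteMeasure (RealRMK.rieszMeasure Λ) := by
    unfold RealRMK.rieszMeasure
    infer_instance
  have hint : Tendsto (fun n => ∫ x, G n x ∂(RealRMK.rieszMeasure Λ)) atTop (𝓝 0) := by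
    have := MeasureTheory.tendsto_integral_of_dominated_convergence
      (μ := RealRMK.rieszMeasure Λ) (F := fun n => G n) (f := fun _ => (0 : ℝ)) (fun _ => B)
      (fun n => (G n).continuous.aestronglyMeasurable) (MeasureTheory.integrable_const _)
      (fun n => .of_forall fun x => by simpa [G] using hB n x x.2)
      (.of_forall fun x => by simpa [G] using (hg x x.2).abs)
    simpa using this
  simp only [RealRMK.integral_rieszMeasure] at hint
  obtain ⟨n, hn⟩ := (hint.eventually (gt_mem_nhds hε)).exists
  refine ⟨n, ?_⟩
  filter_upwards [(hL (G n).toContinuousMap).eventually (gt_mem_nhds hn), hA] with y hy hAy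
  refine (abs_pairing_le _ _).trans_lt ?_
  rw [← hAy fun x => |g n x|]
  exact hy

/-! ### Spaces in which countable sets have compact closure -/

/-- Every countable subset of `X` is contained in a compact set. -/
def OmegaBounded (X : Type u) [TopologicalSpace X] : Prop :=
  ∀ s : Set X, s.Countable → ∃ K, IsCompact K ∧ s ⊆ K

/-- A countably infinite subset lies in a compact set and so accumulates; thus `s` is countably
compact, and being Lindelöf it is compact. -/
theorem OmegaBounded.isCompact_of_isSigmaCompact {X : Type u} [TopologicalSpace X] [T2Space X]
    (hX : OmegaBounded X) {s : Set X} (hs : IsClosed s) (hσ : IsSigmaCompact s) : IsCompact s := by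
  have hcc : IsCountablyCompact s :=
    isCountablyCompact_iff_infinite_subset_has_accPt.2 fun B hB hinf => by
      let e := Set.Infinite.natEmbedding B hinf
      let t : Set X := range fun n => (e n : X)
      have htB : t ⊆ B := range_subset_iff.2 fun n => (e n).2
      have ht : t.Infinite := infinite_range_of_injective (Subtype.val_injective.comp e.injective)
      obtain ⟨K, hK, htK⟩ := hX t (countable_range _)
      obtain ⟨a, -, ha⟩ := ht.exists_accPt_of_subset_isCompact hK htK
      have ha' : AccPt a (𝓟 B) := ha.mono (principal_mono.2 htB)
      exact ⟨a, hs.closure_subset_iff.2 hB (mem_closure_iff_clusterPt.2 ha'.clusterPt), ha'⟩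
  refine isCompact_of_finite_subcover fun U hU hsU => ?_
  obtain ⟨r, hr, hsr⟩ := hσ.isLindelof.elim_countable_subcover U hU hsU
  obtain ⟨t, -, ht, hst⟩ := hcc.elim_finite_subcover_image hr (fun i _ => hU i) hsr
  exact ⟨ht.toFinset, by simpa using hst⟩

/-- Each point of `C` has a neighbourhood with such a function, and products glue finitely many of
them. -/
theorem exists_continuousMap_eventually_eq_one {Y : Type v} [TopologicalSpace Y] [T35Space Y]
    (U : Ultrafilter Y) {C : Set Y} (hC : IsCompact C) (hU : ∀ y ∈ C, ¬ (U : Filter Y) ≤ 𝓝 y) :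
    ∃ f : C(Y, ℝ), (∀ y ∈ C, f y = 0) ∧ (∀ y, |f y| ≤ 1) ∧ ∀ᶠ y in U, f y = 1 := by
  refine hC.induction_on (p := fun C => ∃ f : C(Y, ℝ), (∀ y ∈ C, f y = 0) ∧ (∀ y, |f y| ≤ 1) ∧
    ∀ᶠ y in U, f y = 1) ?_ ?_ ?_ ?_
  · exact ⟨1, by simp⟩
  · rintro s t hst ⟨f, hf, h⟩
    exact ⟨f, fun y hy => hf y (hst hy), h⟩
  · rintro s t ⟨f, hf0, hf, hf1⟩ ⟨g, hg0, hg, hg1⟩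
    refine ⟨f * g, ?_, fun y => ?_, ?_⟩
    · rintro y (hy | hy)
      · simp [hf0 y hy]
      · simp [hg0 y hy]
    · simpa [abs_mul] using mul_le_one₀ (hf y) (abs_nonneg _) (hg y)
    · filter_upwards [hf1, hg1] with y h1 h2
      simp [h1, h2]
  · intro y hy
    obtain ⟨V, hV, hVU⟩ := Filter.not_le.1 (hU y hy)
    obtain ⟨O, hOV, hO, hyO⟩ := mem_nhds_iff.1 hV
    have hOU : Oᶜ ∈ U := Ultrafilter.compl_mem_iff_notMem.2 fun h => hVU (mem_of_superset h hOV)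
    obtain ⟨f, hfy, hf0, hf1⟩ :=
      exists_continuousMap_one_zero hO.isClosed_compl (by simpa using hyO)
    refine ⟨{z | 1 / 2 < f z}, mem_nhdsWithin_of_mem_nhds
      (f.continuous.continuousAt.eventually (lt_mem_nhds (by rw [hfy]; norm_num))),
      -- It vanishes where `f` exceeds 1/2, a whole neighbourhood of y, and is 1 off `O`, which is
      -- not in `U`.
      ⟨fun z => 1 - min 1 (2 * f z), by fun_prop⟩, fun z hz => ?_, fun z => ?_, ?_⟩
    · have : 1 ≤ 2 * f z := by
        have : 1 / 2 < f z := hz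
        linarith
      simp [this]
    · have h0 := (hf1 z).1
      have : 0 ≤ min 1 (2 * f z) := le_min zero_le_one (by linarith)
      have : min 1 (2 * f z) ≤ 1 := min_le_left _ _
      rw [ContinuousMap.coe_mk, abs_le]
      constructor <;> linarith
    · filter_upwards [hOU] with z hz
      simp [hf0 z hz]

namespace WeakDuality

variable {X : Type u} {Y : Type v} [TopologicalSpace X] [TopologicalSpace Y]
  [T35Space X] [T35Space Y]

/-- For a nonconvergent ultrafilter on `Z`, take `f n` zero on level n within `Z` but 1 along `U`.
The pullbacks are uniformly bounded and tend to 0 pointwise on K, so for some n their pairings with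
`toX y` are eventually below 1; but those pairings are `f n y` = 1. -/
theorem isCompact_of_support_subset (d : WeakDuality X Y) {K : Set X} {Z : Set Y}
    (hK : IsCompact K) (hZ : IsClosed Z)
    (hZK : ∀ y ∈ Z, ((d.toX y).support : Set X) ⊆ K)
    (hKZ : ∀ x ∈ K, ((d.toY x).support : Set Y) ⊆ Z) : IsCompact Z := by
  rw [isCompact_iff_ultrafilter_le_nhds]
  intro U hUZ
  rw [le_principal_iff] at hUZ
  by_contra! hU
  choose f hf0 hf1 hfU using fun n => exists_continuousMap_eventually_eq_one U
    ((d.isCompact_level hK n).inter_right hZ) fun y hy => hU y hy.2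
  obtain ⟨M, hM⟩ := d.exists_sum_abs_toX_le hK
  obtain ⟨B, hB⟩ := d.exists_sum_abs_toY_le hK
  obtain ⟨n, hn⟩ := exists_eventually_abs_pairing_lt hK U d.toX (M := M)
    (mem_of_superset hUZ hZK) (mem_of_superset hUZ fun y hy => hM y (hZK y hy))
    (fun n => d.pull (f n)) (B := B)
    (fun n x hx => (abs_pairing_le _ _).trans <|
      (Finset.sum_le_sum fun y _ => mul_le_of_le_one_right (abs_nonneg _) (hf1 n y)).trans (hB x hx))
    (fun x hx => by
      -- The finitely many support points of `toY x` lie in `Z`, and once n exceeds their sizes `f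
      -- n` vanishes on all of them.
      refine tendsto_const_nhds.congr' ?_
      filter_upwards [eventually_ge_atTop ((d.toY x).support.sup d.size)] with n hn
      refine (pairing_eq_zero fun y hy => hf0 n y ⟨?_, hKZ x hx hy⟩).symm
      exact d.mem_level (hZK y (hKZ x hx hy)) ((Finset.le_sup hy).trans hn))
    one_pos
  obtain ⟨y, hy, hy1⟩ := (hn.and (hfU n)).exists
  rw [pairing_pull, hy1] at hy
  norm_num at hy

/-- Closing a countable set under passing to supports back and forth yields countable sets in both
spaces. Their closures satisfy the hypotheses of `isCompact_of_support_subset`, since the support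
conditions are closed. -/
theorem omegaBounded (d : WeakDuality X Y) (hX : OmegaBounded X) : OmegaBounded Y := by
  intro s hs
  let next : Set Y → Set Y := fun t =>
    ⋃ y ∈ t, ⋃ x ∈ (d.toX y).support, ((d.toY x).support : Set Y)
  let E : ℕ → Set Y := fun n => next^[n] s
  have hE : ∀ n, (E n).Countable := by
    intro n
    induction n with
    | zero => exact hs
    | succ n ih =>
      simp only [E, Function.iterate_succ_apply']
      exact ih.biUnion fun y _ => (Finset.countable_toSet _).biUnion fun x _ =>
        Finset.countable_toSet _
  let D : Set X := ⋃ n, ⋃ y ∈ E n, ((d.toX y).support : Set X)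
  have hD : D.Countable :=
    countable_iUnion fun n => (hE n).biUnion fun y _ => Finset.countable_toSet _
  obtain ⟨K, hK, hDK⟩ := hX D hD
  have hcl : IsClosed {y | ((d.toX y).support : Set X) ⊆ closure D} :=
    d.isClosed_support_subset isClosed_closure
  have hcl' : IsClosed {x | ((d.toY x).support : Set Y) ⊆ closure (⋃ n, E n)} :=
    d.symm.isClosed_support_subset isClosed_closure
  refine ⟨closure (⋃ n, E n), d.isCompact_of_support_subset (hK.closure_of_subset hDK)
    isClosed_closure (fun y hy => ?_) (fun x hx => ?_),
    (subset_iUnion E 0).trans subset_closure⟩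
  · refine closure_minimal (fun y hy => ?_) hcl hy
    obtain ⟨n, hn⟩ := mem_iUnion.1 hy
    exact (subset_iUnion_of_subset n
      (subset_biUnion_of_mem (u := fun y => ((d.toX y).support : Set X)) hn)).trans subset_closure
  · refine closure_minimal (fun x hx => ?_) hcl' hx
    simp only [D, mem_iUnion] at hx
    obtain ⟨n, y, hy, hx⟩ := hx
    refine Subset.trans (fun z hz => mem_iUnion.2 ⟨n + 1, ?_⟩) subset_closure
    simp only [E, Function.iterate_succ_apply']
    exact mem_biUnion hy (mem_biUnion hx hz)

theorem isCompact_setOf_support_subset (d : WeakDuality X Y) (hX : OmegaBounded X) {K : Set X}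
    (hK : IsCompact K) : IsCompact {y | ((d.toX y).support : Set X) ⊆ K} := by
  refine (d.omegaBounded hX).isCompact_of_isSigmaCompact
    (d.isClosed_support_subset hK.isClosed) ⟨d.level K, d.isCompact_level hK, ?_⟩
  ext y
  rw [mem_iUnion]
  exact ⟨fun ⟨n, hn⟩ => d.support_subset_of_mem_level hn, fun hy => ⟨_, d.mem_level hy le_rfl⟩⟩

end WeakDuality

/-! ### Tukey quotients -/

/-- Send K to a compact set containing every y with `s y` ⊆ K. For finite F the union of the `s y`
is finite, so some K in the cofinal family contains it, and its image contains F. -/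
theorem tukeyQuotient_of_finite {X : Type u} {Y : Type v} [TopologicalSpace X]
    [TopologicalSpace Y] (s : Y → Set X) (hs : ∀ y, (s y).Finite)
    (h : ∀ K : Set X, IsCompact K → ∃ L : Set Y, IsCompact L ∧ ∀ y, s y ⊆ K → y ∈ L) :
    TukeyQuotient (finiteSubsets X) (finiteSubsets Y) := by
  choose φ hφ hsφ using fun K : Compacts X => h K K.isCompact
  refine ⟨fun K => ⟨φ K, hφ K⟩, fun C hC F hF => ?_⟩
  have hfin : (⋃ y ∈ (F : Set Y), s y).Finite := Finite.biUnion hF fun y _ => hs y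
  obtain ⟨K, hK, hle⟩ := hC ⟨_, hfin.isCompact⟩ hfin
  exact ⟨_, mem_image_of_mem _ hK, fun y hy => hsφ K y ((subset_biUnion_of_mem hy).trans hle)⟩

namespace WeakDuality

variable {X : Type u} {Y : Type v} [TopologicalSpace X] [TopologicalSpace Y]
  [T35Space X] [T35Space Y]

theorem tukeyQuotient (d : WeakDuality X Y) :
    TukeyQuotient (finiteSubsets X) (finiteSubsets Y) := by
  by_cases hX : OmegaBounded X
  · exact tukeyQuotient_of_finite (fun y => (d.toX y).support) (fun y => Finset.finite_toSet _)
      fun K hK => ⟨_, d.isCompact_setOf_support_subset hX hK, fun y hy => hy⟩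
  · simp only [OmegaBounded, not_forall, not_exists, not_and] at hX
    obtain ⟨t, ht, htK⟩ := hX
    have hne : t.Nonempty := nonempty_iff_ne_empty.2 fun h => htK ∅ isCompact_empty h.subset
    obtain ⟨e, rfl⟩ := ht.exists_eq_range hne
    refine tukeyQuotient_of_finite
      (fun y => ((d.toX y).support : Set X) ∪ e '' Iic (d.size y))
      (fun y => (Finset.finite_toSet _).union ((finite_Iic _).image e)) fun K hK => ?_
    -- Since `e n` is not in K, containment of the enlarged set in K forces `size y` < n.
    obtain ⟨_, ⟨n, rfl⟩, hn⟩ := not_subset.1 (htK K hK)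
    refine ⟨d.level K n, d.isCompact_level hK n, fun y hy => d.mem_level
      (subset_union_left.trans hy) ?_⟩
    by_contra! hlt
    exact hn (hy (Or.inr (mem_image_of_mem e (mem_Iic.2 hlt.le))))

theorem tukeyEquivalent (d : WeakDuality X Y) :
    TukeyEquivalent (finiteSubsets X) (finiteSubsets Y) :=
  ⟨d.tukeyQuotient, d.symm.tukeyQuotient⟩

end WeakDuality

/-! ### Topological isomorphisms of free objects -/

/-- A weak duality from a homeomorphism of spaces of formal combinations. -/
noncomputable def WeakDuality.ofHomeomorph {X : Type u} {Y : Type v} [TopologicalSpace X]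
    [TopologicalSpace Y] {A B : Type*} [TopologicalSpace A] [TopologicalSpace B]
    (iX : X → A) (iY : Y → B) (cX : A → X →₀ ℝ) (cY : B → Y →₀ ℝ)
    (hiX : Continuous iX) (hiY : Continuous iY)
    (hcX : ∀ f : C(X, ℝ), Continuous fun a => pairing (cX a) f)
    (hcY : ∀ f : C(Y, ℝ), Continuous fun b => pairing (cY b) f)
    (hX : ∀ (x : X) (f : X → ℝ), pairing (cX (iX x)) f = f x)
    (hY : ∀ (y : Y) (f : Y → ℝ), pairing (cY (iY y)) f = f y) (e : A ≃ₜ B)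
    (hXY : ∀ (a : A) (f : Y → ℝ),
      pairing (cX a) (fun x => pairing (cY (e (iX x))) f) = pairing (cY (e a)) f)
    (hYX : ∀ (b : B) (f : X → ℝ),
      pairing (cY b) (fun y => pairing (cX (e.symm (iY y))) f) = pairing (cX (e.symm b)) f) :
    WeakDuality X Y where
  toY x := cY (e (iX x))
  toX y := cX (e.symm (iY y))
  continuous_toY f := (hcY f).comp (e.continuous.comp hiX)
  continuous_toX f := (hcX f).comp (e.symm.continuous.comp hiY)
  toX_toY y f := by rw [hXY, e.apply_symm_apply, hY]
  toY_toX x f := by rw [hYX, e.symm_apply_apply, hX]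

/-- The pairing as an additive homomorphism. -/
noncomputable def pairingHom {X : Type u} (f : X → ℝ) : (X →₀ ℝ) →+ ℝ :=
  (Finsupp.linearCombination ℝ f).toAddMonoidHom

namespace FreeTopGroup

variable {X : Type u}

/-- The inclusion of the generators. -/
def of (x : X) : FreeTopGroup X := FreeGroup.of x

@[simp] theorem extend_of {G : Type v} [Group G] (f : X → G) (x : X) : extend f (of x) = f x :=
  FreeGroup.lift_apply_of

theorem hom_ext {G : Type v} [Group G] {φ ψ : FreeTopGroup X →* G}
    (h : ∀ x, φ (of x) = ψ (of x)) : φ = ψ :=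
  FreeGroup.ext_hom _ _ h

/-- The exponent sums of the generators. -/
noncomputable def coeff : FreeTopGroup X →* Multiplicative (X →₀ ℝ) :=
  extend fun x => Multiplicative.ofAdd (Finsupp.single x 1)

theorem pairing_coeff_of (x : X) (f : X → ℝ) : pairing (coeff (of x)).toAdd f = f x := by
  simp [coeff]

/-- Both sides are homomorphisms into a commutative group that agree on generators, so only exponent
sums matter. -/
theorem pairing_coeff {φ : FreeTopGroup X →* Multiplicative ℝ} (a : FreeTopGroup X) :
    pairing (coeff a).toAdd (fun x => (φ (of x)).toAdd) = (φ a).toAdd := by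
  have : (AddMonoidHom.toMultiplicative (pairingHom fun x => (φ (of x)).toAdd)).comp coeff = φ :=
    hom_ext fun x => pairing_coeff_of x _
  exact congrArg Multiplicative.toAdd (DFunLike.congr_fun this a)

variable [TopologicalSpace X]

theorem continuous_of : Continuous (of : X → FreeTopGroup X) := by
  simp only [continuous_iInf_rng, continuous_induced_rng]
  intro G _ _ _ f
  exact f.continuous.congr fun x => (extend_of _ x).symm

theorem continuous_extend {G : Type u} [h₁ : Group G] [h₂ : TopologicalSpace G]
    [h₃ : IsTopologicalGroup G]
    (f : C(X, G)) : Continuous (extend (f : X → G)) :=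
  continuous_iff_le_induced.2 <| iInf_le_of_le G <| iInf_le_of_le h₁ <| iInf_le_of_le h₂ <|
    iInf_le_of_le h₃ <| iInf_le _ f

theorem continuous_pairing_coeff (f : C(X, ℝ)) :
    Continuous fun a : FreeTopGroup X => pairing (coeff a).toAdd f := by
  -- The free topology tests only groups in the universe of X, so ℝ is lifted there.
  let g : C(X, Multiplicative (ULift.{u} ℝ)) :=
    ⟨fun x => Multiplicative.ofAdd (ULift.up (f x)),
      continuous_ofAdd.comp (continuous_uliftUp.comp f.continuous)⟩
  let φ : FreeTopGroup X →* Multiplicative ℝ :=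
    (AddMonoidHom.toMultiplicative (AddEquiv.ulift (α := ℝ)).toAddMonoidHom).comp (extend g)
  have hφ : ∀ x, (φ (of x)).toAdd = f x := fun x => by
    simp only [φ, MonoidHom.comp_apply, extend_of]
    rfl
  have hc : Continuous fun a => (φ a).toAdd :=
    continuous_uliftDown.comp (continuous_toAdd.comp (continuous_extend g))
  refine hc.congr fun a => ?_
  rw [← pairing_coeff]
  simp only [hφ]

/-- The weak duality of a topological isomorphism of free topological groups. -/
noncomputable def weakDuality {Y : Type v} [TopologicalSpace Y]
    (e : FreeTopGroup X ≃ₜ* FreeTopGroup Y) : WeakDuality X Y :=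
  .ofHomeomorph of of (fun a => (coeff a).toAdd) (fun b => (coeff b).toAdd)
    continuous_of continuous_of continuous_pairing_coeff continuous_pairing_coeff
    pairing_coeff_of pairing_coeff_of e.toHomeomorph
    (fun a f => pairing_coeff (φ := (AddMonoidHom.toMultiplicative (pairingHom f)).comp
      (coeff.comp (e : FreeTopGroup X →* FreeTopGroup Y))) a)
    (fun b f => pairing_coeff (φ := (AddMonoidHom.toMultiplicative (pairingHom f)).comp
      (coeff.comp (e.symm : FreeTopGroup Y →* FreeTopGroup X))) b)

end FreeTopGroup

namespace FreeAbelianTopGroup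

variable {X : Type u}

/-- The inclusion of the generators. -/
def of (x : X) : FreeAbelianTopGroup X := FreeAbelianGroup.of x

@[simp] theorem extend_of {G : Type v} [AddCommGroup G] (f : X → G) (x : X) :
    extend f (of x) = f x :=
  FreeAbelianGroup.lift_apply_of f x

theorem hom_ext {G : Type v} [AddCommGroup G] {φ ψ : FreeAbelianTopGroup X →+ G}
    (h : ∀ x, φ (of x) = ψ (of x)) : φ = ψ :=
  FreeAbelianGroup.lift_ext _ _ h

/-- The coefficients of the generators. -/
noncomputable def coeff : FreeAbelianTopGroup X →+ (X →₀ ℝ) :=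
  extend fun x => Finsupp.single x 1

theorem pairing_coeff_of (x : X) (f : X → ℝ) : pairing (coeff (of x)) f = f x := by
  simp [coeff]

theorem pairing_coeff {φ : FreeAbelianTopGroup X →+ ℝ} (a : FreeAbelianTopGroup X) :
    pairing (coeff a) (fun x => φ (of x)) = φ a := by
  have : (pairingHom fun x => φ (of x)).comp coeff = φ := hom_ext fun x => pairing_coeff_of x _
  exact DFunLike.congr_fun this a

variable [TopologicalSpace X]

theorem continuous_of : Continuous (of : X → FreeAbelianTopGroup X) := by
  simp only [continuous_iInf_rng, continuous_induced_rng]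
  intro G _ _ _ f
  exact f.continuous.congr fun x => (extend_of _ x).symm

theorem continuous_extend {G : Type u} [h₁ : AddCommGroup G] [h₂ : TopologicalSpace G]
    [h₃ : IsTopologicalAddGroup G] (f : C(X, G)) : Continuous (extend (f : X → G)) :=
  continuous_iff_le_induced.2 <| iInf_le_of_le G <| iInf_le_of_le h₁ <| iInf_le_of_le h₂ <|
    iInf_le_of_le h₃ <| iInf_le _ f

theorem continuous_pairing_coeff (f : C(X, ℝ)) :
    Continuous fun a : FreeAbelianTopGroup X => pairing (coeff a) f := by
  let g : C(X, ULift.{u} ℝ) := ⟨fun x => ULift.up (f x), continuous_uliftUp.comp f.continuous⟩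
  let φ : FreeAbelianTopGroup X →+ ℝ := (AddEquiv.ulift (α := ℝ)).toAddMonoidHom.comp (extend g)
  have hφ : ∀ x, φ (of x) = f x := fun x => by
    simp only [φ, AddMonoidHom.comp_apply, extend_of]
    rfl
  have hc : Continuous φ := continuous_uliftDown.comp (continuous_extend g)
  refine hc.congr fun a => ?_
  rw [← pairing_coeff]
  simp only [hφ]

/-- The weak duality of a topological isomorphism of free Abelian topological groups. -/
noncomputable def weakDuality {Y : Type v} [TopologicalSpace Y]
    (e : FreeAbelianTopGroup X ≃ₜ+ FreeAbelianTopGroup Y) : WeakDuality X Y :=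
  .ofHomeomorph of of coeff coeff
    continuous_of continuous_of continuous_pairing_coeff continuous_pairing_coeff
    pairing_coeff_of pairing_coeff_of e.toHomeomorph
    (fun a f => pairing_coeff (φ := (pairingHom f).comp
      (coeff.comp (e : FreeAbelianTopGroup X →+ FreeAbelianTopGroup Y))) a)
    (fun b f => pairing_coeff (φ := (pairingHom f).comp
      (coeff.comp (e.symm : FreeAbelianTopGroup Y →+ FreeAbelianTopGroup X))) b)

end FreeAbelianTopGroup

/-- A linear functional on finitely supported functions is the pairing with its values on the
basis. -/
theorem pairing_apply_single {X : Type u} (φ : (X →₀ ℝ) →ₗ[ℝ] ℝ) (a : X →₀ ℝ) :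
    pairing a (fun x => φ (Finsupp.single x 1)) = φ a := by
  have : Finsupp.linearCombination ℝ (fun x => φ (Finsupp.single x 1)) = φ := by
    ext x
    simp
  exact DFunLike.congr_fun this a

theorem pairing_single_one {X : Type u} (x : X) (f : X → ℝ) :
    pairing (Finsupp.single x 1) f = f x := by
  simp

namespace FreeLCS

variable {X : Type u}

/-- The inclusion of the basis. -/
noncomputable def of (x : X) : FreeLCS X := Finsupp.single x (1 : ℝ)

@[simp] theorem extend_of {E : Type v} [AddCommGroup E] [Module ℝ E] (f : X → E) (x : X) :
    extend f (of x) = f x :=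
  (Finsupp.linearCombination_single ℝ 1 x).trans (one_smul ℝ _)

/-- The coordinates with respect to the basis. -/
noncomputable def coeff : FreeLCS X ≃ₗ[ℝ] (X →₀ ℝ) := LinearEquiv.refl ℝ (X →₀ ℝ)

variable [TopologicalSpace X]

theorem continuous_of : Continuous (of : X → FreeLCS X) := by
  simp only [continuous_iInf_rng, continuous_induced_rng]
  intro E _ _ _ _ _ _ f
  exact f.continuous.congr fun x => (extend_of _ x).symm

theorem continuous_extend {E : Type u} [h₁ : AddCommGroup E] [h₂ : Module ℝ E] [h₃ : TopologicalSpace E]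
    [h₄ : IsTopologicalAddGroup E] [h₅ : ContinuousSMul ℝ E] [h₆ : LocallyConvexSpace ℝ E] (f : C(X, E)) :
    Continuous (extend (f : X → E)) :=
  continuous_iff_le_induced.2 <| iInf_le_of_le E <| iInf_le_of_le h₁ <| iInf_le_of_le h₂ <|
    iInf_le_of_le h₃ <| iInf_le_of_le h₄ <| iInf_le_of_le h₅ <| iInf_le_of_le h₆ <| iInf_le _ f

theorem continuous_pairing_coeff (f : C(X, ℝ)) :
    Continuous fun a : FreeLCS X => pairing (coeff a) f := by
  let g : C(X, ULift.{u} ℝ) := ⟨fun x => ULift.up (f x), continuous_uliftUp.comp f.continuous⟩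
  let φ : FreeLCS X →ₗ[ℝ] ℝ := ULift.moduleEquiv.toLinearMap ∘ₗ extend g
  have hφ : ∀ x, φ (of x) = f x := fun x => by
    simp only [φ, LinearMap.comp_apply, extend_of]
    rfl
  have hc : Continuous φ := continuous_uliftDown.comp (continuous_extend g)
  refine hc.congr fun a => ?_
  rw [← funext hφ]
  exact (pairing_apply_single (φ ∘ₗ coeff.symm.toLinearMap) (coeff a)).symm

/-- The weak duality of a topological isomorphism of free locally convex spaces. -/
noncomputable def weakDuality {Y : Type v} [TopologicalSpace Y]
    (e : FreeLCS X ≃L[ℝ] FreeLCS Y) : WeakDuality X Y :=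
  .ofHomeomorph of of coeff coeff
    continuous_of continuous_of continuous_pairing_coeff continuous_pairing_coeff
    pairing_single_one pairing_single_one e.toHomeomorph
    (fun a f => pairing_apply_single (Finsupp.linearCombination ℝ f ∘ₗ coeff.toLinearMap ∘ₗ
      e.toLinearEquiv.toLinearMap ∘ₗ coeff.symm.toLinearMap) a)
    (fun b f => pairing_apply_single (Finsupp.linearCombination ℝ f ∘ₗ coeff.toLinearMap ∘ₗ
      e.symm.toLinearEquiv.toLinearMap ∘ₗ coeff.symm.toLinearMap) b)

end FreeLCS

namespace FreeWeakLCS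

variable {X : Type u}

/-- The inclusion of the basis. -/
noncomputable def of (x : X) : FreeWeakLCS X := Finsupp.single x (1 : ℝ)

@[simp] theorem extend_of (f : X → ℝ) (x : X) : extend f (of x) = f x :=
  (Finsupp.linearCombination_single ℝ 1 x).trans (one_smul ℝ _)

/-- The coordinates with respect to the basis. -/
noncomputable def coeff : FreeWeakLCS X ≃ₗ[ℝ] (X →₀ ℝ) := LinearEquiv.refl ℝ (X →₀ ℝ)

variable [TopologicalSpace X]

theorem continuous_of : Continuous (of : X → FreeWeakLCS X) := by
  simp only [continuous_iInf_rng, continuous_induced_rng]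
  intro f
  exact f.continuous.congr fun x => (extend_of _ x).symm

theorem continuous_pairing_coeff (f : C(X, ℝ)) :
    Continuous fun a : FreeWeakLCS X => pairing (coeff a) f :=
  continuous_iInf_dom (i := f) continuous_induced_dom

/-- The weak duality of a topological isomorphism of the spaces `L_p`. -/
noncomputable def weakDuality {Y : Type v} [TopologicalSpace Y]
    (e : FreeWeakLCS X ≃L[ℝ] FreeWeakLCS Y) : WeakDuality X Y :=
  .ofHomeomorph of of coeff coeff
    continuous_of continuous_of continuous_pairing_coeff continuous_pairing_coeff
    pairing_single_one pairing_single_one e.toHomeomorph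
    (fun a f => pairing_apply_single (Finsupp.linearCombination ℝ f ∘ₗ coeff.toLinearMap ∘ₗ
      e.toLinearEquiv.toLinearMap ∘ₗ coeff.symm.toLinearMap) a)
    (fun b f => pairing_apply_single (Finsupp.linearCombination ℝ f ∘ₗ coeff.toLinearMap ∘ₗ
      e.symm.toLinearEquiv.toLinearMap ∘ₗ coeff.symm.toLinearMap) b)

end FreeWeakLCS

theorem mainTheorem8 {X : Type u} {Y : Type v} [TopologicalSpace X] [TopologicalSpace Y]
    [T35Space X] [T35Space Y] :
    (Nonempty (FreeTopGroup X ≃ₜ* FreeTopGroup Y) →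
      TukeyEquivalent (finiteSubsets X) (finiteSubsets Y)) ∧
    (Nonempty (FreeAbelianTopGroup X ≃ₜ+ FreeAbelianTopGroup Y) →
      TukeyEquivalent (finiteSubsets X) (finiteSubsets Y)) ∧
    (Nonempty (FreeLCS X ≃L[ℝ] FreeLCS Y) →
      TukeyEquivalent (finiteSubsets X) (finiteSubsets Y)) ∧
    (Nonempty (FreeWeakLCS X ≃L[ℝ] FreeWeakLCS Y) →
      TukeyEquivalent (finiteSubsets X) (finiteSubsets Y)) :=
  ⟨fun ⟨e⟩ => (FreeTopGroup.weakDuality e).tukeyEquivalent,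
    fun ⟨e⟩ => (FreeAbelianTopGroup.weakDuality e).tukeyEquivalent,
    fun ⟨e⟩ => (FreeLCS.weakDuality e).tukeyEquivalent,
    fun ⟨e⟩ => (FreeWeakLCS.weakDuality e).tukeyEquivalent⟩
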